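/- Let $\mathbf H$ be the quaternions with units $i,j,k$ and norm $|\cdot|$. For $m=1,2$ let $A_m=(a_m,b_m,c_m,d_m\,|\,r_m,s_m)$ be real parameters with $a_md_m-b_mc_m=1$. For $\mu\in\{i,j\}$ put, with principal square roots taken in the plane $\mathbf R+\mathbf R\mu\cong\mathbf C$, $$K^{\mu}_{A}(x,v)=\frac{1}{\sqrt{2\pi b\mu}}\,e^{\frac{\mu}{2b}\left[ax^2+2x(r-v)-2v(dr-bs)+d(v^2+r^2)\right]}\quad(b\neq 0),\qquad C^{\mu}_{A}(v)=\sqrt{d}\,e^{\mu\left(\frac{cd}{2}(v-r)^2+vr\right)}\quad(b=0).$$ For $f,g\in L^2(\mathbf R^2,\mathbf H)$ put $h_{f,g}(t,n)=f(t+\tfrac n2)\,\overline{g(t-\tfrac n2)}$. The Wigner–Ville distribution of $f,g$ associated with the two-sided quaternionic offset linear canonical transform (WVD-QOLCT) is defined, for $t=(t_1,t_2)$ and $u=(u_1,u_2)$ in $\mathbf R^2$, by $$\mathcal W^{A_1,A_2}_{f,g}(t,u)=\begin{cases}\displaystyle\int_{\mathbf R^2}K^i_{A_1}(n_1,u_1)\,h_{f,g}(t,n)\,K^j_{A_2}(n_2,u_2)\,dn,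 & b_1,b_2\ne0,\\[1ex] \displaystyle\int_{\mathbf R}C^i_{A_1}(u_1)\,h_{f,g}\big(t,(d_1(u_1-r_1),n_2)\big)\,K^j_{A_2}(n_2,u_2)\,dn_2, & b_1=0,\ b_2\neq0,\\[1ex] \displaystyle\int_{\mathbf R}K^i_{A_1}(n_1,u_1)\,h_{f,g}\big(t,(n_1,d_2(u_2-r_2))\big)\,C^j_{A_2}(u_2)\,dn_1, & b_1\neq0,\ b_2=0,\\[1ex] C^i_{A_1}(u_1)\,h_{f,g}\big(t,(d_1(u_1-r_1),d_2(u_2-r_2))\big)\,C^j_{A_2}(u_2), & b_1=b_2=0\end{cases}$$ (in the second and third cases the integral converges absolutely for almost every $(t,u)$, and $\mathcal W^{A_1,A_2}_{f,g}(t,u)$ is set to $0$ where it does not). **Theorem (Plancherel's theorem for the WVD-QOLCT).** For all $f,g\in L^2(\mathbf R^2,\mathbf H)$, the function $\mathcal W^{A_1,A_2}_{f,g}$ belongs to $L^2(\mathbf R^2\times\mathbf R^2,\mathbf H)$ and $$\int_{\mathbf R^2}\int_{\mathbf R^2}\big|\mathcal W^{A_1,A_2}_{f,g}(t,u)\big|^2\,du\,dt=\big\|\mathcal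 W^{A_1,A_2}_{f,g}\big\|^2_{L^2(\mathbf R^2\times\mathbf R^2,\mathbf H)}=\|f\|^2_{L^2(\mathbf R^2,\mathbf H)}\,\|g\|^2_{L^2(\mathbf R^2,\mathbf H)}.$$ -/

import Mathlib

open MeasureTheory

open scoped Quaternion

/-- Parameters `(a, b, c, d | r, s)` of an offset linear canonical transform, with
`a * d - b * c = 1`. -/
structure OLCTParam where
  a : ℝ
  b : ℝ
  c : ℝ
  d : ℝ
  r : ℝ
  s : ℝ
  det_eq_one : a * d - b * c = 1

/-- The quaternion unit `i`. -/
def quatI : ℍ := ⟨0, 1, 0, 0⟩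

/-- The quaternion unit `j`. -/
def quatJ : ℍ := ⟨0, 0, 1, 0⟩

/-- For a quaternion `μ` with `μ ^ 2 = -1`, the copy `x + y μ` of the complex number `x + y i`
in the plane spanned by `1` and `μ`. -/
noncomputable def inPlane (μ : ℍ) (z : ℂ) : ℍ := (z.re : ℍ) + z.im • μ

/-- The kernel of the offset linear canonical transform for `b ≠ 0`, as a complex number:
`(2 π b i)^(-1/2) * exp (i / (2 b) * (a x² + 2 x (r - u) - 2 u (d r - b s) + d (u² + r²)))`,
with the principal square root. -/
noncomputable def olctKernelC (A : OLCTParam) (x u : ℝ) : ℂ :=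
  1 / (2 * (Real.pi : ℂ) * (A.b : ℂ) * Complex.I) ^ (1 / 2 : ℂ) *
    Complex.exp (Complex.I / (2 * (A.b : ℂ)) *
      ((A.a * x ^ 2 + 2 * x * (A.r - u) - 2 * u * (A.d * A.r - A.b * A.s)
        + A.d * (u ^ 2 + A.r ^ 2) : ℝ) : ℂ))

/-- The chirp factor that replaces the kernel when `b = 0`:
`√d * exp (i (c d / 2 * (u - r)² + u r))`, with the principal square root. -/
noncomputable def olctChirpC (A : OLCTParam) (u : ℝ) : ℂ :=
  (A.d : ℂ) ^ (1 / 2 : ℂ) *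
    Complex.exp (Complex.I *
      ((A.c * A.d / 2 * (u - A.r) ^ 2 + u * A.r : ℝ) : ℂ))

/-- The quaternion kernel `K_A^μ(x, u)`, with values in the plane spanned by `1` and `μ`. -/
noncomputable def quatKernel (μ : ℍ) (A : OLCTParam) (x u : ℝ) : ℍ :=
  inPlane μ (olctKernelC A x u)

/-- The quaternion chirp, with values in the plane spanned by `1` and `μ`. -/
noncomputable def quatChirp (μ : ℍ) (A : OLCTParam) (u : ℝ) : ℍ :=
  inPlane μ (olctChirpC A u)

/-- The quaternion correlation product `h_{f,g}(t, n) = f(t + n/2) * conj (g(t - n/2))`. -/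
noncomputable def corrProduct (f g : ℝ × ℝ → ℍ) (t n : ℝ × ℝ) : ℍ :=
  f (t + (1 / 2 : ℝ) • n) * star (g (t - (1 / 2 : ℝ) • n))

/-- The (cross) Wigner-Ville distribution of `f` and `g` associated with the two-sided
quaternionic offset linear canonical transform. If `b₁ = 0` or `b₂ = 0`, the integration over the
corresponding variable `nₖ` is replaced by evaluation at `nₖ = dₖ (uₖ - rₖ)` and multiplication
by the chirp. -/
noncomputable def wvdQOLCT (A₁ A₂ : OLCTParam) (f g : ℝ × ℝ → ℍ) (t u : ℝ × ℝ) : ℍ :=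
  if A₁.b = 0 then
    if A₂.b = 0 then
      quatChirp quatI A₁ u.1 *
        corrProduct f g t (A₁.d * (u.1 - A₁.r), A₂.d * (u.2 - A₂.r)) *
        quatChirp quatJ A₂ u.2
    else
      ∫ n₂ : ℝ, quatChirp quatI A₁ u.1 *
        corrProduct f g t (A₁.d * (u.1 - A₁.r), n₂) *
        quatKernel quatJ A₂ n₂ u.2
  else
    if A₂.b = 0 then
      ∫ n₁ : ℝ, quatKernel quatI A₁ n₁ u.1 *
        corrProduct f g t (n₁, A₂.d * (u.2 - A₂.r)) *
        quatChirp quatJ A₂ u.2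
    else
      ∫ n : ℝ × ℝ, quatKernel quatI A₁ n.1 u.1 *
        corrProduct f g t n *
        quatKernel quatJ A₂ n.2 u.2

/-! For fixed `t`, the distribution is the two-sided transform of `n ↦ corrProduct f g t n`, so the
theorem reduces to two facts: this transform is an `L²` isometry (`lintegral_enorm_sq_qolct`), and
the correlation product has squared norm `‖f‖² ‖g‖²` over all `(t, n)`
(`lintegral_enorm_sq_corrProduct`).

For the isometry, ℍ is the orthogonal sum of the planes `i q = q j` and `i q = -q j`. On them, left
multiplication by `z` in the `i`-plane together with right multiplication by `w` in the `j`-plane is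
multiplication by the complex scalar `z w`, respectively `conj z * w`. The quaternionic integral
thus splits into two complex ones. Their kernels are a constant times unimodular chirps times a
rescaled Fourier kernel, and the constant squared is the Jacobian of the rescaling, so complex
Plancherel applies. A variable with `b = 0` is only an affine substitution, with Jacobian `|d|`
equal to the squared modulus of the chirp.

Norms are compared as `ℝ≥0∞`-valued integrals. The correlation product is `L¹` in `n` for every `t`,
and `L²` for almost every `t`, so Plancherel is needed only on `L¹ ∩ L²`. -/

/-! ### Plancherel for the Fourier integral on `L¹ ∩ L²`. -/

section Plancherel

open SchwartzMap FourierTransform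
open scoped ContDiff

variable {V : Type*} [NormedAddCommGroup V] [InnerProductSpace ℝ V] [FiniteDimensional ℝ V]
  [MeasurableSpace V] [BorelSpace V]

/-- On `L¹ ∩ L²` the Fourier integral represents the `L²` Fourier transform. -/
theorem fourier_ae_eq_fourier_toLp {G : V → ℂ} (h1 : Integrable G) (h2 : MemLp G 2) :
    𝓕 G =ᵐ[volume] (𝓕 (h2.toLp G) : Lp ℂ 2 (volume : Measure V)) := by
  set H : Lp ℂ 2 (volume : Measure V) := 𝓕 (h2.toLp G) with hH
  have hcont : Continuous (𝓕 G) :=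
    VectorFourier.fourierIntegral_continuous Real.continuous_fourierChar
      (L := innerₗ V) continuous_inner h1
  have hHloc : LocallyIntegrable H (volume : Measure V) :=
    (Lp.memLp H).locallyIntegrable (by norm_num)
  -- Both sides are locally integrable, so it suffices to test against smooth compactly supported
  -- functions. The test function is complexified to a Schwartz function, and the Fourier transform
  -- is moved onto it on each side: by the distributional definition for `H`, by Fubini for `𝓕 G`.
  have key : ∀ᵐ x ∂(volume : Measure V), (𝓕 G) x - H x = 0 := by
    apply ae_eq_zero_of_integral_contDiff_smul_eq_zero
    · exact hcont.locallyIntegrable.sub hHloc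
    · intro φ hφ hφc
      have hg₁ : HasCompactSupport (Complex.ofRealCLM ∘ φ) := hφc.comp_left rfl
      have hg₂ : ContDiff ℝ ∞ (Complex.ofRealCLM ∘ φ) := by fun_prop
      set ψ : 𝓢(V, ℂ) := hg₁.toSchwartzMap hg₂ with hψ
      have hψφ : ∀ x, ψ x = (φ x : ℂ) := fun x => by simp [hψ]
      have e1 : ∫ x, ψ x • H x = ∫ x, (𝓕 ψ) x • G x := by
        have := congrArg (fun T => T ψ) (Lp.fourier_toTemperedDistribution_eq (h2.toLp G))
        simp only [TemperedDistribution.fourier_apply, Lp.toTemperedDistribution_apply] at this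
        rw [hH, ← this]
        apply integral_congr_ae
        filter_upwards [h2.coeFn_toLp] with x hx
        rw [hx]
      have e2 : ∫ x, (𝓕 ψ) x • G x = ∫ x, ψ x • (𝓕 G) x := by
        simpa using! (VectorFourier.integral_fourierIntegral_smul_eq_flip (L := innerₗ V)
          Real.continuous_fourierChar continuous_inner ψ.integrable h1)
      have e3 : ∫ x, φ x • ((𝓕 G) x - H x) = ∫ x, (φ x • (𝓕 G) x - φ x • H x) := by
        simp only [smul_sub]
      rw [e3, integral_sub, sub_eq_zero]
      · simpa [hψφ] using (e1.trans e2).symm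
      · exact hcont.locallyIntegrable.integrable_smul_left_of_hasCompactSupport hφ.continuous hφc
      · exact hHloc.integrable_smul_left_of_hasCompactSupport hφ.continuous hφc
  filter_upwards [key] with x hx using sub_eq_zero.mp hx

theorem lintegral_enorm_sq_eq_eLpNorm {X E : Type*} [MeasurableSpace X] {μ : Measure X}
    [NormedAddCommGroup E] (f : X → E) :
    ∫⁻ x, ‖f x‖ₑ ^ 2 ∂μ = eLpNorm f 2 μ ^ 2 := by
  have := eLpNorm_nnreal_pow_eq_lintegral (f := f) (μ := μ) (p := 2) (by norm_num)
  simpa using this.symm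

theorem lintegral_enorm_sq_fourier {G : V → ℂ} (h1 : Integrable G) (h2 : MemLp G 2) :
    ∫⁻ ξ, ‖𝓕 G ξ‖ₑ ^ 2 = ∫⁻ x, ‖G x‖ₑ ^ 2 := by
  rw [lintegral_enorm_sq_eq_eLpNorm, lintegral_enorm_sq_eq_eLpNorm,
    eLpNorm_congr_ae (fourier_ae_eq_fourier_toLp h1 h2), ← Lp.enorm_def,
    ← eLpNorm_congr_ae h2.coeFn_toLp, ← Lp.enorm_def]
  congr 1
  rw [← ofReal_norm, ← ofReal_norm, Lp.norm_fourier_eq]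

end Plancherel

/-! ### Affine changes of variable in lower integrals. -/

section Scaling

/-- Scaling is a measurable equivalence, so `F` may be non-measurable; this is used later for
section integrals of functions that are only a.e. measurable. -/
theorem ofReal_abs_mul_lintegral_comp_mul_left (F : ℝ → ENNReal) {a : ℝ} (ha : a ≠ 0) :
    ENNReal.ofReal |a| * ∫⁻ x, F (a * x) = ∫⁻ x, F x := by
  have : ∫⁻ x, F x ∂(Measure.map (a * ·) volume) = ∫⁻ x, F (a * x) :=
    lintegral_map_equiv F (MeasurableEquiv.mulLeft₀ a ha)
  rw [← this, ← smul_eq_mul, ← lintegral_smul_measure, Real.smul_map_volume_mul_left ha]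

theorem ofReal_abs_mul_lintegral_comp_mul_sub (F : ℝ → ENNReal) {a : ℝ} (ha : a ≠ 0) (r : ℝ) :
    ENNReal.ofReal |a| * ∫⁻ x, F (a * (x - r)) = ∫⁻ x, F x := by
  rw [lintegral_sub_right_eq_self (fun x => F (a * x)) r,
    ofReal_abs_mul_lintegral_comp_mul_left F ha]

theorem ofReal_abs_mul_lintegral_comp_mul_prod {F : ℝ × ℝ → ENNReal} (hF : Measurable F)
    {a b : ℝ} (ha : a ≠ 0) (hb : b ≠ 0) :
    ENNReal.ofReal |a| * ENNReal.ofReal |b| * ∫⁻ x : ℝ × ℝ, F (a * x.1, b * x.2) =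
      ∫⁻ x, F x := by
  rw [Measure.volume_eq_prod, lintegral_prod _ (by fun_prop), lintegral_prod _ (by fun_prop),
    ← ofReal_abs_mul_lintegral_comp_mul_left (fun x => ∫⁻ y, F (x, y)) ha, mul_assoc,
    ← lintegral_const_mul _ (by fun_prop)]
  congr 1
  exact lintegral_congr fun x => ofReal_abs_mul_lintegral_comp_mul_left (fun y => F (a * x, y)) hb

/-- Transfers statements about almost every section `x` to the sections `x = d (u - r)` that occur
when `b = 0`. -/
theorem quasiMeasurePreserving_mul_sub {a : ℝ} (ha : a ≠ 0) (r : ℝ) :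
    Measure.QuasiMeasurePreserving (fun x : ℝ => a * (x - r)) := by
  refine ⟨by fun_prop, ?_⟩
  refine Measure.AbsolutelyContinuous.mk fun s hs h0 => ?_
  rw [Measure.map_apply (by fun_prop) hs]
  have := ofReal_abs_mul_lintegral_comp_mul_sub (s.indicator 1) ha r
  rw [lintegral_indicator_one hs, h0, mul_eq_zero] at this
  rcases this with h | h
  · simp [ha] at h
  · rw [← lintegral_indicator_one (hs.preimage (by fun_prop)), ← h]
    rfl

end Scaling

/-! ### Complex chirp-Fourier kernels and their isometry property. -/

section Kernels

open FourierTransform ComplexConjugate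

/-- A bounded jointly measurable kernel whose integral operator preserves the `L²` norm of
functions in `L¹ ∩ L²`. -/
structure IsIsometricKernel {X U : Type*} [MeasureSpace X] [MeasureSpace U] (k : X → U → ℂ) :
    Prop where
  measurable : Measurable (Function.uncurry k)
  bounded : ∃ C, ∀ x u, ‖k x u‖ ≤ C
  isometry : ∀ G : X → ℂ, Integrable G → MemLp G 2 →
    ∫⁻ u, ‖∫ x, k x u * G x‖ₑ ^ 2 = ∫⁻ x, ‖G x‖ₑ ^ 2

/-- A kernel of the form `c p(x) q(u) exp(-2πi β x u)` with unimodular `p`, `q` and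
`|c|² = |β| ≠ 0`. -/
structure IsChirpFourierKernel (β : ℝ) (k : ℝ → ℝ → ℂ) : Prop where
  ne_zero : β ≠ 0
  exists_factors : ∃ (c : ℂ) (p q : ℝ → ℂ), ‖c‖ ^ 2 = |β| ∧ Continuous p ∧ Continuous q ∧
    (∀ x, ‖p x‖ = 1) ∧ (∀ u, ‖q u‖ = 1) ∧
    ∀ x u, k x u = c * p x * q u * Complex.exp ((-2 * Real.pi * x * (β * u) : ℝ) * Complex.I)

theorem enorm_sq_eq_ofReal_abs {c : ℂ} {β : ℝ} (h : ‖c‖ ^ 2 = |β|) :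
    ‖c‖ₑ ^ 2 = ENNReal.ofReal |β| := by
  rw [← h, ← ofReal_norm, ENNReal.ofReal_pow (norm_nonneg _)]

theorem enorm_eq_one {E : Type*} [NormedAddCommGroup E] {z : E} (h : ‖z‖ = 1) : ‖z‖ₑ = 1 := by
  rw [← ofReal_norm, h, ENNReal.ofReal_one]

theorem IsChirpFourierKernel.continuous {β : ℝ} {k : ℝ → ℝ → ℂ} (hk : IsChirpFourierKernel β k) :
    Continuous (Function.uncurry k) := by
  obtain ⟨c, p, q, -, hp, hq, -, -, hk⟩ := hk.exists_factors
  have : Function.uncurry k = fun z : ℝ × ℝ => c * p z.1 * q z.2 *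
      Complex.exp ((-2 * Real.pi * z.1 * (β * z.2) : ℝ) * Complex.I) := by
    ext z; exact hk _ _
  rw [this]
  fun_prop

theorem IsChirpFourierKernel.measurable_left {β : ℝ} {k : ℝ → ℝ → ℂ}
    (hk : IsChirpFourierKernel β k) (u : ℝ) : Measurable fun x => k x u :=
  (hk.continuous.comp (continuous_id.prodMk continuous_const)).measurable

theorem IsChirpFourierKernel.norm_sq {β : ℝ} {k : ℝ → ℝ → ℂ} (hk : IsChirpFourierKernel β k)
    (x u : ℝ) : ‖k x u‖ ^ 2 = |β| := by
  obtain ⟨c, p, q, hc, -, -, hp1, hq1, hk⟩ := hk.exists_factors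
  rw [hk, norm_mul, norm_mul, norm_mul, hp1, hq1, Complex.norm_exp_ofReal_mul_I, mul_one, mul_one,
    mul_one, hc]

theorem IsChirpFourierKernel.norm_eq {β : ℝ} {k : ℝ → ℝ → ℂ} (hk : IsChirpFourierKernel β k)
    (x u : ℝ) : ‖k x u‖ = √|β| := by
  rw [← hk.norm_sq x u, Real.sqrt_sq (norm_nonneg _)]

/-- The plane `i q = -q j` sees the left kernel conjugated. -/
theorem IsChirpFourierKernel.conj {β : ℝ} {k : ℝ → ℝ → ℂ} (hk : IsChirpFourierKernel β k) :
    IsChirpFourierKernel (-β) (fun x u => conj (k x u)) := by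
  refine ⟨neg_ne_zero.mpr hk.ne_zero, ?_⟩
  obtain ⟨c, p, q, hc, hp, hq, hp1, hq1, hk⟩ := hk.exists_factors
  refine ⟨conj c, fun x => conj (p x), fun u => conj (q u), by simpa using hc,
    Complex.continuous_conj.comp hp, Complex.continuous_conj.comp hq, by simpa using hp1,
    by simpa using hq1, fun x u => ?_⟩
  rw [hk]
  simp only [map_mul, ← Complex.exp_conj, Complex.conj_ofReal, Complex.conj_I]
  congr 2
  push_cast
  ring

/-- The cross term `-2 x u / (2 b)` of the phase equals `-2π x (β u)` for `β = 1 / (2π b)`; the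
remaining terms depend on `x` alone or on `u` alone. -/
theorem isChirpFourierKernel_olctKernelC (A : OLCTParam) (hb : A.b ≠ 0) :
    IsChirpFourierKernel (1 / (2 * Real.pi * A.b)) (olctKernelC A) := by
  have hpi := Real.pi_ne_zero
  refine ⟨by positivity, 1 / (2 * (Real.pi : ℂ) * (A.b : ℂ) * Complex.I) ^ (1 / 2 : ℂ),
    fun x => Complex.exp (((A.a * x ^ 2 + 2 * x * A.r) / (2 * A.b) : ℝ) * Complex.I),
    fun u => Complex.exp (((- 2 * u * (A.d * A.r - A.b * A.s) + A.d * (u ^ 2 + A.r ^ 2))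
      / (2 * A.b) : ℝ) * Complex.I), ?_, by fun_prop, by fun_prop,
    fun x => Complex.norm_exp_ofReal_mul_I _, fun u => Complex.norm_exp_ofReal_mul_I _, ?_⟩
  · rw [← norm_pow, div_pow, ← Complex.cpow_nat_mul]
    simp [abs_of_pos Real.pi_pos]
  · intro x u
    beta_reduce
    rw [olctKernelC, mul_assoc (_ / _), mul_assoc (_ / _), ← Complex.exp_add, ← Complex.exp_add]
    congr 2
    have hb' : (A.b : ℂ) ≠ 0 := by exact_mod_cast hb
    have hpi' : (Real.pi : ℂ) ≠ 0 := by exact_mod_cast hpi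
    push_cast
    field_simp
    ring

theorem integrable_unimodular_mul {X : Type*} [MeasureSpace X] {G p : X → ℂ}
    (hp : AEStronglyMeasurable p) (hp1 : ∀ x, ‖p x‖ = 1) (h1 : Integrable G) :
    Integrable (fun x => p x * G x) :=
  h1.mono (hp.mul h1.1) (Filter.Eventually.of_forall fun x => by simp [hp1])

theorem memLp_unimodular_mul {X : Type*} [MeasureSpace X] {G p : X → ℂ}
    (hp : AEStronglyMeasurable p) (hp1 : ∀ x, ‖p x‖ = 1) (h2 : MemLp G 2) :
    MemLp (fun x => p x * G x) 2 :=
  h2.mono (hp.mul h2.1) (Filter.Eventually.of_forall fun x => by simp [hp1])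

theorem continuous_fourier {V : Type*} [NormedAddCommGroup V] [InnerProductSpace ℝ V]
    [FiniteDimensional ℝ V] [MeasurableSpace V] [BorelSpace V] {G : V → ℂ} (h : Integrable G) :
    Continuous (𝓕 G) :=
  VectorFourier.fourierIntegral_continuous Real.continuous_fourierChar
    (L := innerₗ V) continuous_inner h

/-- The factor `p` is absorbed into `G`, `q` has no effect on the modulus, and `‖c‖² = |β|`
compensates the substitution `u ↦ β u`. -/
theorem IsChirpFourierKernel.isIsometricKernel {β : ℝ} {k : ℝ → ℝ → ℂ}
    (hk : IsChirpFourierKernel β k) : IsIsometricKernel k := by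
  refine ⟨hk.continuous.measurable, ⟨√|β|, fun x u => (hk.norm_eq x u).le⟩, fun G h1 h2 => ?_⟩
  have hβ := hk.ne_zero
  obtain ⟨c, p, q, hc, hp, hq, hp1, hq1, hk⟩ := hk.exists_factors
  have hI := integrable_unimodular_mul hp.aestronglyMeasurable hp1 h1
  have hF : ∀ u, ∫ x, k x u * G x = c * q u * 𝓕 (fun x => p x * G x) (β * u) := by
    intro u
    rw [Real.fourier_real_eq_integral_exp_smul, ← integral_const_mul]
    refine integral_congr_ae (Filter.Eventually.of_forall fun x => ?_)
    simp only [hk, smul_eq_mul]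
    ring
  simp_rw [hF, enorm_mul, mul_pow, enorm_eq_one (hq1 _), one_pow, mul_one]
  have hm : Measurable fun u => ‖𝓕 (fun x => p x * G x) (β * u)‖ₑ ^ 2 :=
    ((continuous_fourier hI).comp (continuous_const_mul β)).measurable.enorm.pow_const 2
  rw [lintegral_const_mul _ hm, enorm_sq_eq_ofReal_abs hc,
    ofReal_abs_mul_lintegral_comp_mul_left (fun y => ‖𝓕 (fun x => p x * G x) y‖ₑ ^ 2) hβ,
    lintegral_enorm_sq_fourier hI (memLp_unimodular_mul hp.aestronglyMeasurable hp1 h2)]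
  simp_rw [enorm_mul, enorm_eq_one (hp1 _), one_mul]

/-- Same argument in two variables. Since `ℝ × ℝ` carries the sup norm, the Fourier transform is
taken on `ℂ`, the Euclidean plane, through the measure-preserving identification of the two. -/
theorem IsChirpFourierKernel.isIsometricKernel_prod {β γ : ℝ} {k l : ℝ → ℝ → ℂ}
    (hk : IsChirpFourierKernel β k) (hl : IsChirpFourierKernel γ l) :
    IsIsometricKernel (fun x u : ℝ × ℝ => k x.1 u.1 * l x.2 u.2) := by
  refine ⟨?_, ⟨√|β| * √|γ|, fun x u => by rw [norm_mul, hk.norm_eq, hl.norm_eq]⟩,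
    fun G h1 h2 => ?_⟩
  · have e1 : Measurable fun z : (ℝ × ℝ) × ℝ × ℝ => Function.uncurry k (z.1.1, z.2.1) :=
      hk.continuous.measurable.comp (by fun_prop)
    have e2 : Measurable fun z : (ℝ × ℝ) × ℝ × ℝ => Function.uncurry l (z.1.2, z.2.2) :=
      hl.continuous.measurable.comp (by fun_prop)
    exact e1.mul e2
  have hβ := hk.ne_zero
  have hγ := hl.ne_zero
  obtain ⟨c, p, q, hc, hp, hq, hp1, hq1, hk⟩ := hk.exists_factors
  obtain ⟨c', p', q', hc', hp', hq', hp1', hq1', hl⟩ := hl.exists_factors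
  have hP : AEStronglyMeasurable (fun x : ℝ × ℝ => p x.1 * p' x.2) :=
    Continuous.aestronglyMeasurable (by fun_prop)
  have hP1 : ∀ x : ℝ × ℝ, ‖p x.1 * p' x.2‖ = 1 := fun x => by rw [norm_mul, hp1, hp1', one_mul]
  set g : ℝ × ℝ → ℂ := fun x => p x.1 * p' x.2 * G x with hg
  have hI : Integrable g := integrable_unimodular_mul hP hP1 h1
  have hL : MemLp g 2 := memLp_unimodular_mul hP hP1 h2
  have hmp := Complex.volume_preserving_equiv_real_prod
  have hI' : Integrable (fun z : ℂ => g (z.re, z.im)) := hmp.integrable_comp_of_integrable hI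
  have hL' : MemLp (fun z : ℂ => g (z.re, z.im)) 2 := hL.comp_measurePreserving hmp
  set F : ℂ → ℂ := 𝓕 (fun z : ℂ => g (z.re, z.im)) with hFdef
  have hFc : Continuous F := continuous_fourier hI'
  have hF : ∀ u : ℝ × ℝ, ∫ x : ℝ × ℝ, k x.1 u.1 * l x.2 u.2 * G x =
      c * c' * (q u.1 * q' u.2) * F ⟨β * u.1, γ * u.2⟩ := by
    intro u
    rw [hFdef, Real.fourier_eq', ← integral_const_mul,
      ← hmp.integral_comp Complex.measurableEquivRealProd.measurableEmbedding]
    refine integral_congr_ae (Filter.Eventually.of_forall fun z => ?_)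
    simp only [hk, hl, smul_eq_mul, Complex.measurableEquivRealProd_apply, hg, Complex.inner,
      Complex.mul_re, Complex.conj_re, Complex.conj_im]
    rw [show ((-2 * Real.pi * (β * u.1 * z.re - γ * u.2 * -z.im) : ℝ) : ℂ) * Complex.I =
      ((-2 * Real.pi * z.re * (β * u.1) : ℝ) : ℂ) * Complex.I +
      ((-2 * Real.pi * z.im * (γ * u.2) : ℝ) : ℂ) * Complex.I by push_cast; ring, Complex.exp_add]
    ring
  have hFm : Measurable fun u : ℝ × ℝ => ‖F ⟨u.1, u.2⟩‖ₑ ^ 2 :=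
    ((hFc.measurable.comp Complex.measurableEquivRealProd.symm.measurable).enorm).pow_const 2
  simp_rw [hF, enorm_mul, mul_pow, enorm_eq_one (hq1 _), enorm_eq_one (hq1' _), one_pow, mul_one]
  have hm : Measurable fun u : ℝ × ℝ => ‖F ⟨β * u.1, γ * u.2⟩‖ₑ ^ 2 :=
    hFm.comp (g := fun u : ℝ × ℝ => ‖F ⟨u.1, u.2⟩‖ₑ ^ 2)
      (f := fun u : ℝ × ℝ => (β * u.1, γ * u.2)) (by fun_prop)
  rw [lintegral_const_mul _ hm,
    enorm_sq_eq_ofReal_abs hc, enorm_sq_eq_ofReal_abs hc',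
    ofReal_abs_mul_lintegral_comp_mul_prod hFm hβ hγ,
    ← hmp.lintegral_comp_emb Complex.measurableEquivRealProd.measurableEmbedding]
  simp only [Complex.measurableEquivRealProd_apply, Complex.eta]
  rw [hFdef, lintegral_enorm_sq_fourier hI' hL',
    ← hmp.lintegral_comp_emb Complex.measurableEquivRealProd.measurableEmbedding]
  refine lintegral_congr fun z => ?_
  simp only [Complex.measurableEquivRealProd_apply, hg]
  rw [enorm_mul, enorm_eq_one (hP1 (z.re, z.im)), one_mul]

end Kernels

/-! ### Orthogonal splitting of the quaternions and the abstract two-sided isometry. -/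

section QuaternionSplit

open ComplexConjugate

/-- The coordinate `(a - d) + (b + c) i` of `a + b i + c j + d k` with respect to the plane
`{q | i q = q j}`. -/
noncomputable def splitMinus : ℍ →L[ℝ] ℂ :=
  LinearMap.toContinuousLinearMap
    { toFun := fun q => ⟨q.re - q.imK, q.imI + q.imJ⟩
      map_add' := fun p q => by apply Complex.ext <;> simp <;> ring
      map_smul' := fun r q => by apply Complex.ext <;> simp <;> ring }

/-- The coordinate `(a + d) + (c - b) i` of `a + b i + c j + d k` with respect to the plane
`{q | i q = -q j}`. -/
noncomputable def splitPlus : ℍ →L[ℝ] ℂ :=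
  LinearMap.toContinuousLinearMap
    { toFun := fun q => ⟨q.re + q.imK, q.imJ - q.imI⟩
      map_add' := fun p q => by apply Complex.ext <;> simp <;> ring
      map_smul' := fun r q => by apply Complex.ext <;> simp <;> ring }

theorem splitMinus_apply (q : ℍ) : splitMinus q = ⟨q.re - q.imK, q.imI + q.imJ⟩ := rfl

theorem splitPlus_apply (q : ℍ) : splitPlus q = ⟨q.re + q.imK, q.imJ - q.imI⟩ := rfl

theorem inPlane_quatI_re (z : ℂ) : (inPlane quatI z).re = z.re := by
  have h : quatI.re = 0 := rfl
  simp [inPlane, h]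

theorem inPlane_quatI_imI (z : ℂ) : (inPlane quatI z).imI = z.im := by
  have h : quatI.imI = 1 := rfl
  simp [inPlane, h]

theorem inPlane_quatI_imJ (z : ℂ) : (inPlane quatI z).imJ = 0 := by
  have h : quatI.imJ = 0 := rfl
  simp [inPlane, h]

theorem inPlane_quatI_imK (z : ℂ) : (inPlane quatI z).imK = 0 := by
  have h : quatI.imK = 0 := rfl
  simp [inPlane, h]

theorem inPlane_quatJ_re (z : ℂ) : (inPlane quatJ z).re = z.re := by
  have h : quatJ.re = 0 := rfl
  simp [inPlane, h]

theorem inPlane_quatJ_imI (z : ℂ) : (inPlane quatJ z).imI = 0 := by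
  have h : quatJ.imI = 0 := rfl
  simp [inPlane, h]

theorem inPlane_quatJ_imJ (z : ℂ) : (inPlane quatJ z).imJ = z.im := by
  have h : quatJ.imJ = 1 := rfl
  simp [inPlane, h]

theorem inPlane_quatJ_imK (z : ℂ) : (inPlane quatJ z).imK = 0 := by
  have h : quatJ.imK = 0 := rfl
  simp [inPlane, h]

/-- On the plane `i q = q j`, left multiplication by `i` and right multiplication by `j` are the
same complex structure; on the other plane they are opposite, whence the conjugate in
`splitPlus_mul_mul`. -/
theorem splitMinus_mul_mul (z w : ℂ) (q : ℍ) :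
    splitMinus (inPlane quatI z * q * inPlane quatJ w) = z * w * splitMinus q := by
  rw [splitMinus_apply, splitMinus_apply]
  apply Complex.ext <;>
  · simp only [Quaternion.re_mul, Quaternion.imI_mul, Quaternion.imJ_mul, Quaternion.imK_mul,
      inPlane_quatI_re, inPlane_quatI_imI, inPlane_quatI_imJ, inPlane_quatI_imK,
      inPlane_quatJ_re, inPlane_quatJ_imI, inPlane_quatJ_imJ, inPlane_quatJ_imK,
      Complex.mul_re, Complex.mul_im]
    ring

theorem splitPlus_mul_mul (z w : ℂ) (q : ℍ) :
    splitPlus (inPlane quatI z * q * inPlane quatJ w) = conj z * w * splitPlus q := by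
  rw [splitPlus_apply, splitPlus_apply]
  apply Complex.ext <;>
  · simp only [Quaternion.re_mul, Quaternion.imI_mul, Quaternion.imJ_mul, Quaternion.imK_mul,
      inPlane_quatI_re, inPlane_quatI_imI, inPlane_quatI_imJ, inPlane_quatI_imK,
      inPlane_quatJ_re, inPlane_quatJ_imI, inPlane_quatJ_imJ, inPlane_quatJ_imK,
      Complex.mul_re, Complex.mul_im, Complex.conj_re, Complex.conj_im]
    ring

theorem quaternion_norm_sq (q : ℍ) :
    ‖q‖ ^ 2 = q.re ^ 2 + q.imI ^ 2 + q.imJ ^ 2 + q.imK ^ 2 := by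
  rw [sq ‖q‖, ← Quaternion.normSq_eq_norm_mul_self, Quaternion.normSq_def']

theorem norm_inPlane_quatI (z : ℂ) : ‖inPlane quatI z‖ = ‖z‖ := by
  rw [← sq_eq_sq₀ (norm_nonneg _) (norm_nonneg _), quaternion_norm_sq, Complex.sq_norm, Complex.normSq_apply,
    inPlane_quatI_re, inPlane_quatI_imI, inPlane_quatI_imJ, inPlane_quatI_imK]
  ring

theorem norm_inPlane_quatJ (z : ℂ) : ‖inPlane quatJ z‖ = ‖z‖ := by
  rw [← sq_eq_sq₀ (norm_nonneg _) (norm_nonneg _), quaternion_norm_sq, Complex.sq_norm, Complex.normSq_apply,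
    inPlane_quatJ_re, inPlane_quatJ_imI, inPlane_quatJ_imJ, inPlane_quatJ_imK]
  ring

theorem inPlane_one (μ : ℍ) : inPlane μ 1 = 1 := by simp [inPlane]

theorem continuous_inPlane (μ : ℍ) : Continuous (inPlane μ) := by
  unfold inPlane
  exact (Quaternion.continuous_coe.comp Complex.continuous_re).add
    (Complex.continuous_im.smul continuous_const)

/-- The planes are orthogonal; the 2 appears because the coordinates are not normalised. -/
theorem enorm_sq_splitMinus_add_splitPlus (q : ℍ) :
    ‖splitMinus q‖ₑ ^ 2 + ‖splitPlus q‖ₑ ^ 2 = 2 * ‖q‖ₑ ^ 2 := by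
  have h : ‖splitMinus q‖ ^ 2 + ‖splitPlus q‖ ^ 2 = 2 * ‖q‖ ^ 2 := by
    rw [quaternion_norm_sq, splitMinus_apply, splitPlus_apply, Complex.sq_norm, Complex.sq_norm,
      Complex.normSq_mk, Complex.normSq_mk]
    ring
  have e2 : (2 : ENNReal) = ENNReal.ofReal 2 := by simp
  rw [← ofReal_norm, ← ofReal_norm, ← ofReal_norm, ← ENNReal.ofReal_pow (norm_nonneg _),
    ← ENNReal.ofReal_pow (norm_nonneg _), ← ENNReal.ofReal_pow (norm_nonneg _),
    ← ENNReal.ofReal_add (by positivity) (by positivity), h, e2,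
    ENNReal.ofReal_mul (by norm_num)]

variable {X U : Type*} [MeasureSpace X] [MeasureSpace U]

theorem IsIsometricKernel.aestronglyMeasurable_integral [SFinite (volume : Measure X)]
    [SFinite (volume : Measure U)] {k : X → U → ℂ}
    (hk : IsIsometricKernel k) {G : X → ℂ} (hG : AEStronglyMeasurable G) :
    AEStronglyMeasurable fun u => ∫ x, k x u * G x := by
  have h1 : AEStronglyMeasurable (fun z : U × X => k z.2 z.1)
      ((volume : Measure U).prod volume) :=
    (hk.measurable.comp measurable_swap).aestronglyMeasurable
  exact (h1.mul hG.comp_snd).integral_prod_right'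

/-- The two coordinates are real-linear and continuous, so they commute with the integral and reduce
the claim to the kernels `k l` and `conj k * l`. With general `k` and `l`, the one-sided transforms
are the cases where one of them is 1. -/
theorem lintegral_enorm_sq_two_sided [SFinite (volume : Measure X)]
    [SFinite (volume : Measure U)] {k l : X → U → ℂ}
    (hkm : ∀ u, Measurable fun x => k x u) (hlm : ∀ u, Measurable fun x => l x u)
    (hkb : ∃ C, ∀ x u, ‖k x u‖ ≤ C) (hlb : ∃ C, ∀ x u, ‖l x u‖ ≤ C)
    (h₁ : IsIsometricKernel fun x u => k x u * l x u)
    (h₂ : IsIsometricKernel fun x u => conj (k x u) * l x u)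
    {h : X → ℍ} (hi : Integrable h) (h2 : MemLp h 2) :
    ∫⁻ u, ‖∫ x, inPlane quatI (k x u) * h x * inPlane quatJ (l x u)‖ₑ ^ 2 =
      ∫⁻ x, ‖h x‖ₑ ^ 2 := by
  obtain ⟨C, hC⟩ := hkb
  obtain ⟨D, hD⟩ := hlb
  have hint : ∀ u, Integrable fun x => inPlane quatI (k x u) * h x * inPlane quatJ (l x u) := by
    intro u
    refine (hi.norm.const_mul (C * D)).mono' ?_ (Filter.Eventually.of_forall fun x => ?_)
    · exact (((continuous_inPlane _).comp_aestronglyMeasurable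
        (hkm u).aestronglyMeasurable).mul hi.1).mul
        ((continuous_inPlane _).comp_aestronglyMeasurable (hlm u).aestronglyMeasurable)
    · rw [norm_mul, norm_mul, norm_inPlane_quatI, norm_inPlane_quatJ]
      have := mul_le_mul (hC x u) (hD x u) (norm_nonneg _) ((norm_nonneg _).trans (hC x u))
      nlinarith [norm_nonneg (h x)]
  have hm : ∀ u, splitMinus (∫ x, inPlane quatI (k x u) * h x * inPlane quatJ (l x u)) =
      ∫ x, k x u * l x u * splitMinus (h x) := fun u => by
    rw [← splitMinus.integral_comp_comm (hint u)]
    simp_rw [splitMinus_mul_mul]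
  have hp : ∀ u, splitPlus (∫ x, inPlane quatI (k x u) * h x * inPlane quatJ (l x u)) =
      ∫ x, conj (k x u) * l x u * splitPlus (h x) := fun u => by
    rw [← splitPlus.integral_comp_comm (hint u)]
    simp_rw [splitPlus_mul_mul]
  have im := splitMinus.integrable_comp hi
  have ip := splitPlus.integrable_comp hi
  have key : 2 * ∫⁻ u, ‖∫ x, inPlane quatI (k x u) * h x * inPlane quatJ (l x u)‖ₑ ^ 2 =
      2 * ∫⁻ x, ‖h x‖ₑ ^ 2 := by
    rw [← lintegral_const_mul' _ _ (by simp), ← lintegral_const_mul' _ _ (by simp)]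
    simp_rw [← enorm_sq_splitMinus_add_splitPlus, hm, hp]
    rw [lintegral_add_left' ((h₁.aestronglyMeasurable_integral im.1).enorm.pow_const 2),
      lintegral_add_left' (im.1.enorm.pow_const 2),
      h₁.isometry _ im (splitMinus.comp_memLp' h2),
      h₂.isometry _ ip (splitPlus.comp_memLp' h2)]
  exact (ENNReal.mul_right_inj (by simp) (by simp)).mp key

end QuaternionSplit

/-! ### Isometry for the quaternion kernels, and moduli of the chirps. -/

section QuaternionKernels

theorem lintegral_enorm_sq_quatKernel_both {A₁ A₂ : OLCTParam} (hb₁ : A₁.b ≠ 0) (hb₂ : A₂.b ≠ 0)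
    {h : ℝ × ℝ → ℍ} (hi : Integrable h) (h2 : MemLp h 2) :
    ∫⁻ u : ℝ × ℝ, ‖∫ n : ℝ × ℝ,
      quatKernel quatI A₁ n.1 u.1 * h n * quatKernel quatJ A₂ n.2 u.2‖ₑ ^ 2 =
      ∫⁻ n, ‖h n‖ₑ ^ 2 := by
  have hk := isChirpFourierKernel_olctKernelC A₁ hb₁
  have hl := isChirpFourierKernel_olctKernelC A₂ hb₂
  exact lintegral_enorm_sq_two_sided (k := fun n u : ℝ × ℝ => olctKernelC A₁ n.1 u.1)
    (l := fun n u : ℝ × ℝ => olctKernelC A₂ n.2 u.2)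
    (fun u => (hk.measurable_left u.1).comp measurable_fst)
    (fun u => (hl.measurable_left u.2).comp measurable_snd)
    ⟨_, fun n u => (hk.norm_eq n.1 u.1).le⟩ ⟨_, fun n u => (hl.norm_eq n.2 u.2).le⟩
    (hk.isIsometricKernel_prod hl) (hk.conj.isIsometricKernel_prod hl) hi h2

theorem lintegral_enorm_sq_mul_quatKernel {A : OLCTParam} (hb : A.b ≠ 0)
    {h : ℝ → ℍ} (hi : Integrable h) (h2 : MemLp h 2) :
    ∫⁻ u, ‖∫ n, h n * quatKernel quatJ A n u‖ₑ ^ 2 = ∫⁻ n, ‖h n‖ₑ ^ 2 := by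
  have hl := isChirpFourierKernel_olctKernelC A hb
  have := lintegral_enorm_sq_two_sided (k := fun _ _ => 1) (l := olctKernelC A)
    (fun u => measurable_const)
    hl.measurable_left
    ⟨1, fun n u => by simp⟩ ⟨_, fun n u => (hl.norm_eq n u).le⟩
    (by simpa using hl.isIsometricKernel) (by simpa using hl.isIsometricKernel) hi h2
  simpa only [inPlane_one, one_mul, quatKernel] using this

theorem lintegral_enorm_sq_quatKernel_mul {A : OLCTParam} (hb : A.b ≠ 0)
    {h : ℝ → ℍ} (hi : Integrable h) (h2 : MemLp h 2) :
    ∫⁻ u, ‖∫ n, quatKernel quatI A n u * h n‖ₑ ^ 2 = ∫⁻ n, ‖h n‖ₑ ^ 2 := by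
  have hk := isChirpFourierKernel_olctKernelC A hb
  have := lintegral_enorm_sq_two_sided (k := olctKernelC A) (l := fun _ _ => 1)
    hk.measurable_left
    (fun u => measurable_const)
    ⟨_, fun n u => (hk.norm_eq n u).le⟩ ⟨1, fun n u => by simp⟩
    (by simpa using hk.isIsometricKernel) (by simpa using hk.conj.isIsometricKernel) hi h2
  simpa only [inPlane_one, mul_one, quatKernel] using this

/-- This constant is exactly the Jacobian of `u ↦ d (u - r)`. -/
theorem norm_sq_olctChirpC (A : OLCTParam) (u : ℝ) : ‖olctChirpC A u‖ ^ 2 = |A.d| := by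
  rw [olctChirpC, norm_mul, mul_comm Complex.I, Complex.norm_exp_ofReal_mul_I, mul_one,
    ← norm_pow, ← Complex.cpow_nat_mul]
  simp

theorem enorm_sq_quatChirp_quatI (A : OLCTParam) (u : ℝ) :
    ‖quatChirp quatI A u‖ₑ ^ 2 = ENNReal.ofReal |A.d| := by
  rw [quatChirp, ← norm_sq_olctChirpC A u, ← norm_inPlane_quatI, ← ofReal_norm,
    ENNReal.ofReal_pow (norm_nonneg _)]

theorem enorm_sq_quatChirp_quatJ (A : OLCTParam) (u : ℝ) :
    ‖quatChirp quatJ A u‖ₑ ^ 2 = ENNReal.ofReal |A.d| := by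
  rw [quatChirp, ← norm_sq_olctChirpC A u, ← norm_inPlane_quatJ, ← ofReal_norm,
    ENNReal.ofReal_pow (norm_nonneg _)]

theorem OLCTParam.d_ne_zero {A : OLCTParam} (hb : A.b = 0) : A.d ≠ 0 := by
  intro hd
  have := A.det_eq_one
  simp [hb, hd] at this

theorem Continuous.quatChirp {Y : Type*} [TopologicalSpace Y] {u : Y → ℝ} (μ : ℍ)
    (A : OLCTParam) (hu : Continuous u) : Continuous fun y => quatChirp μ A (u y) := by
  unfold _root_.quatChirp olctChirpC
  exact (continuous_inPlane μ).comp (by fun_prop)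

theorem Continuous.quatKernel {Y : Type*} [TopologicalSpace Y] {x u : Y → ℝ} (μ : ℍ)
    {A : OLCTParam} (hb : A.b ≠ 0) (hx : Continuous x) (hu : Continuous u) :
    Continuous fun y => quatKernel μ A (x y) (u y) := by
  have h := (isChirpFourierKernel_olctKernelC A hb).continuous.comp (hx.prodMk hu)
  have h' : Continuous fun y => olctKernelC A (x y) (u y) := h
  unfold _root_.quatKernel
  exact (continuous_inPlane μ).comp' h'

end QuaternionKernels

/-! ### The two-sided transform is isometric in all four cases. -/

section Transform

/-- The two-sided quaternionic offset linear canonical transform. -/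
noncomputable def qolct (A₁ A₂ : OLCTParam) (h : ℝ × ℝ → ℍ) (u : ℝ × ℝ) : ℍ :=
  if A₁.b = 0 then
    if A₂.b = 0 then
      quatChirp quatI A₁ u.1 * h (A₁.d * (u.1 - A₁.r), A₂.d * (u.2 - A₂.r)) *
        quatChirp quatJ A₂ u.2
    else
      ∫ n₂ : ℝ, quatChirp quatI A₁ u.1 * h (A₁.d * (u.1 - A₁.r), n₂) * quatKernel quatJ A₂ n₂ u.2
  else
    if A₂.b = 0 then
      ∫ n₁ : ℝ, quatKernel quatI A₁ n₁ u.1 * h (n₁, A₂.d * (u.2 - A₂.r)) * quatChirp quatJ A₂ u.2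
    else
      ∫ n : ℝ × ℝ, quatKernel quatI A₁ n.1 u.1 * h n * quatKernel quatJ A₂ n.2 u.2

theorem memLp_two_section_right_ae {h : ℝ × ℝ → ℍ} (h2 : MemLp h 2) :
    ∀ᵐ x : ℝ, MemLp (fun y : ℝ => h (x, y)) 2 := by
  have hm : ∀ᵐ x : ℝ, AEStronglyMeasurable fun y : ℝ => h (x, y) := h2.1.prodMk_left
  filter_upwards [hm, ((memLp_two_iff_integrable_sq_norm h2.1).mp h2).prod_right_ae] with x h1 h2
  exact (memLp_two_iff_integrable_sq_norm h1).mpr h2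

theorem memLp_two_section_left_ae {h : ℝ × ℝ → ℍ} (h2 : MemLp h 2) :
    ∀ᵐ y : ℝ, MemLp (fun x : ℝ => h (x, y)) 2 :=
  memLp_two_section_right_ae (h := fun z => h z.swap)
    (h2.comp_measurePreserving Measure.measurePreserving_swap)

/-- If some `b` vanishes, Fubini isolates that variable: the squared chirp pays for the substitution
there, and the other variable is handled likewise or by the one-dimensional isometry on almost every
line. -/
theorem lintegral_enorm_sq_qolct {A₁ A₂ : OLCTParam} {h : ℝ × ℝ → ℍ} (hi : Integrable h)
    (h2 : MemLp h 2) (hQ : AEStronglyMeasurable (qolct A₁ A₂ h)) :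
    ∫⁻ u, ‖qolct A₁ A₂ h u‖ₑ ^ 2 = ∫⁻ n, ‖h n‖ₑ ^ 2 := by
  have hQm := hQ.enorm.pow_const 2
  have hm := h2.1.enorm.pow_const 2
  by_cases hb₁ : A₁.b = 0
  · have hd₁ := OLCTParam.d_ne_zero hb₁
    have hQMP := quasiMeasurePreserving_mul_sub hd₁ A₁.r
    rw [Measure.volume_eq_prod] at hQm hm ⊢
    rw [lintegral_prod _ hQm, lintegral_prod _ hm,
      ← ofReal_abs_mul_lintegral_comp_mul_sub (fun x => ∫⁻ y, ‖h (x, y)‖ₑ ^ 2) hd₁ A₁.r,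
      ← lintegral_const_mul' _ _ ENNReal.ofReal_ne_top]
    by_cases hb₂ : A₂.b = 0
    · have hd₂ := OLCTParam.d_ne_zero hb₂
      refine lintegral_congr fun u₁ => ?_
      rw [← ofReal_abs_mul_lintegral_comp_mul_sub
          (fun y => ‖h (A₁.d * (u₁ - A₁.r), y)‖ₑ ^ 2) hd₂ A₂.r,
        ← lintegral_const_mul' _ _ ENNReal.ofReal_ne_top,
        ← lintegral_const_mul' _ _ ENNReal.ofReal_ne_top]
      refine lintegral_congr fun u₂ => ?_
      rw [qolct, if_pos hb₁, if_pos hb₂, enorm_mul, enorm_mul, mul_pow, mul_pow,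
        enorm_sq_quatChirp_quatI, enorm_sq_quatChirp_quatJ]
      ring
    · refine lintegral_congr_ae ?_
      -- The chirp does not depend on `n₂`, so it is absorbed into the section as a constant.
      -- Sections that fail to be `L¹ ∩ L²` form a null set of `u₁`; whatever value the integral
      -- takes there is irrelevant.
      filter_upwards [hQMP.ae hi.prod_right_ae,
        hQMP.ae (memLp_two_section_right_ae h2)] with u₁ hi₁ h2₁
      have := lintegral_enorm_sq_mul_quatKernel hb₂
        (hi₁.const_mul (quatChirp quatI A₁ u₁)) (h2₁.const_mul (quatChirp quatI A₁ u₁))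
      simp only [enorm_mul, mul_pow, enorm_sq_quatChirp_quatI] at this
      rw [← lintegral_const_mul' _ _ ENNReal.ofReal_ne_top, ← this]
      simp only [qolct, if_pos hb₁, if_neg hb₂]
  · by_cases hb₂ : A₂.b = 0
    · have hd₂ := OLCTParam.d_ne_zero hb₂
      have hQMP := quasiMeasurePreserving_mul_sub hd₂ A₂.r
      rw [Measure.volume_eq_prod] at hQm hm ⊢
      -- The substituted variable is now the second one, so it must be the outer variable.
      rw [lintegral_prod_symm _ hQm, lintegral_prod_symm _ hm,
        ← ofReal_abs_mul_lintegral_comp_mul_sub (fun y => ∫⁻ x, ‖h (x, y)‖ₑ ^ 2) hd₂ A₂.r,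
        ← lintegral_const_mul' _ _ ENNReal.ofReal_ne_top]
      refine lintegral_congr_ae ?_
      filter_upwards [hQMP.ae hi.prod_left_ae,
        hQMP.ae (memLp_two_section_left_ae h2)] with u₂ hi₂ h2₂
      have := lintegral_enorm_sq_quatKernel_mul hb₁
        (hi₂.mul_const (quatChirp quatJ A₂ u₂)) (h2₂.mul_const (quatChirp quatJ A₂ u₂))
      simp only [enorm_mul, mul_pow, enorm_sq_quatChirp_quatJ] at this
      simp_rw [mul_comm _ (ENNReal.ofReal |A₂.d|)] at this
      rw [← lintegral_const_mul' _ _ ENNReal.ofReal_ne_top, ← this]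
      simp only [qolct, if_neg hb₁, if_pos hb₂, mul_assoc]
    · simp only [qolct, if_neg hb₁, if_neg hb₂]
      exact lintegral_enorm_sq_quatKernel_both hb₁ hb₂ hi h2

end Transform

/-! ### Measurability and norm of the correlation product, and the resulting identity. -/

section Correlation

variable {f g : ℝ × ℝ → ℍ}

/-- For each fixed second coordinate the map is a translation, so no condition beyond measurability
falls on `φ`. One lemma therefore covers both integration over `n` and evaluation at a point
depending on `u`. -/
theorem quasiMeasurePreserving_add_comp {E Y : Type*} [MeasurableSpace E] [AddGroup E]
    [MeasurableAdd₂ E] {μ : Measure E} [SFinite μ] [μ.IsAddRightInvariant]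
    [MeasurableSpace Y] {ν : Measure Y}
    [SFinite ν] {φ : Y → E} (hφ : Measurable φ) :
    Measure.QuasiMeasurePreserving (fun z : E × Y => z.1 + φ z.2) (μ.prod ν) μ :=
  QuasiMeasurePreserving.prod_of_left (measurable_fst.add (hφ.comp measurable_snd))
    (Filter.Eventually.of_forall fun y =>
      (measurePreserving_add_right μ (φ y)).quasiMeasurePreserving)

theorem aestronglyMeasurable_corrProduct {Y : Type*} [MeasurableSpace Y] {ν : Measure Y}
    [SFinite ν] (hf : AEStronglyMeasurable f) (hg : AEStronglyMeasurable g) {φ : Y → ℝ × ℝ}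
    (hφ : Measurable φ) :
    AEStronglyMeasurable (fun z : (ℝ × ℝ) × Y => corrProduct f g z.1 (φ z.2))
      ((volume : Measure (ℝ × ℝ)).prod ν) := by
  have h1 := hf.comp_quasiMeasurePreserving (quasiMeasurePreserving_add_comp
    (μ := (volume : Measure (ℝ × ℝ))) (ν := ν) (hφ.const_smul (1 / 2 : ℝ)))
  have h2 := hg.comp_quasiMeasurePreserving (quasiMeasurePreserving_add_comp
    (μ := (volume : Measure (ℝ × ℝ))) (ν := ν) (hφ.const_smul (1 / 2 : ℝ)).neg)
  refine h1.mul (continuous_star.comp_aestronglyMeasurable (h2.congr ?_))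
  exact Filter.Eventually.of_forall fun z => by simp [sub_eq_add_neg]

theorem AEStronglyMeasurable.prod_assoc {α β γ E : Type*} [MeasurableSpace α] [MeasurableSpace β]
    [MeasurableSpace γ] [TopologicalSpace E] {μ : Measure α} {ν : Measure β} {ρ : Measure γ}
    [SFinite μ] [SFinite ν] [SFinite ρ] {F : α × β × γ → E}
    (hF : AEStronglyMeasurable F (μ.prod (ν.prod ρ))) :
    AEStronglyMeasurable (fun z : (α × β) × γ => F (z.1.1, z.1.2, z.2)) ((μ.prod ν).prod ρ) :=
  hF.comp_measurePreserving (measurePreserving_prodAssoc μ ν ρ)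

theorem aestronglyMeasurable_corrProduct_assoc {U N : Type*} [MeasurableSpace U]
    [MeasurableSpace N] {ν : Measure U} {ρ : Measure N} [SFinite ν] [SFinite ρ]
    (hf : AEStronglyMeasurable f) (hg : AEStronglyMeasurable g) {φ : U × N → ℝ × ℝ}
    (hφ : Measurable φ) :
    AEStronglyMeasurable
      (fun z : ((ℝ × ℝ) × U) × N => corrProduct f g z.1.1 (φ (z.1.2, z.2)))
      (((volume : Measure (ℝ × ℝ)).prod ν).prod ρ) := by
  exact AEStronglyMeasurable.prod_assoc
    (F := fun w : (ℝ × ℝ) × U × N => corrProduct f g w.1 (φ w.2))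
    (aestronglyMeasurable_corrProduct hf hg hφ)

theorem aestronglyMeasurable_integral_mul_corrProduct_mul {U N : Type*}
    [TopologicalSpace U] [MeasurableSpace U] [OpensMeasurableSpace U]
    [SecondCountableTopology U] [TopologicalSpace N] [MeasurableSpace N] [OpensMeasurableSpace N]
    [SecondCountableTopology N]
    {ν : Measure U} {ρ : Measure N} [SFinite ν] [SFinite ρ]
    (hf : AEStronglyMeasurable f) (hg : AEStronglyMeasurable g) {φ : U × N → ℝ × ℝ}
    (hφ : Measurable φ) {k l : U × N → ℍ} (hk : Continuous k) (hl : Continuous l) :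
    AEStronglyMeasurable
      (fun p : (ℝ × ℝ) × U =>
        ∫ n, k (p.2, n) * corrProduct f g p.1 (φ (p.2, n)) * l (p.2, n) ∂ρ)
      ((volume : Measure (ℝ × ℝ)).prod ν) := by
  have hk' : Continuous fun z : ((ℝ × ℝ) × U) × N => k (z.1.2, z.2) := by fun_prop
  have hl' : Continuous fun z : ((ℝ × ℝ) × U) × N => l (z.1.2, z.2) := by fun_prop
  have h := (hk'.aestronglyMeasurable.mul
    (aestronglyMeasurable_corrProduct_assoc (ν := ν) (ρ := ρ) hf hg hφ)).mul
    hl'.aestronglyMeasurable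
  exact h.integral_prod_right'

theorem aestronglyMeasurable_wvdQOLCT (A₁ A₂ : OLCTParam) (hf : AEStronglyMeasurable f)
    (hg : AEStronglyMeasurable g) :
    AEStronglyMeasurable (fun p : (ℝ × ℝ) × (ℝ × ℝ) => wvdQOLCT A₁ A₂ f g p.1 p.2)
      ((volume : Measure (ℝ × ℝ)).prod volume) := by
  have hc₁ : Continuous fun w : (ℝ × ℝ) × ℝ => quatChirp quatI A₁ w.1.1 :=
    .quatChirp _ _ (by fun_prop)
  have hc₂ : Continuous fun w : (ℝ × ℝ) × ℝ => quatChirp quatJ A₂ w.1.2 :=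
    .quatChirp _ _ (by fun_prop)
  by_cases hb₁ : A₁.b = 0
  · by_cases hb₂ : A₂.b = 0
    · simp only [wvdQOLCT, if_pos hb₁, if_pos hb₂]
      have h₁ : Continuous fun p : (ℝ × ℝ) × (ℝ × ℝ) => quatChirp quatI A₁ p.2.1 :=
        .quatChirp _ _ (by fun_prop)
      have h₂ : Continuous fun p : (ℝ × ℝ) × (ℝ × ℝ) => quatChirp quatJ A₂ p.2.2 :=
        .quatChirp _ _ (by fun_prop)
      have hφ : Measurable fun u : ℝ × ℝ => (A₁.d * (u.1 - A₁.r), A₂.d * (u.2 - A₂.r)) := by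
        fun_prop
      exact (h₁.aestronglyMeasurable.mul (aestronglyMeasurable_corrProduct hf hg hφ)).mul
        h₂.aestronglyMeasurable
    · simp only [wvdQOLCT, if_pos hb₁, if_neg hb₂]
      have hk₂ : Continuous fun w : (ℝ × ℝ) × ℝ => quatKernel quatJ A₂ w.2 w.1.2 :=
        .quatKernel _ hb₂ (by fun_prop) (by fun_prop)
      have hφ : Measurable fun w : (ℝ × ℝ) × ℝ => (A₁.d * (w.1.1 - A₁.r), w.2) := by fun_prop
      have h := aestronglyMeasurable_integral_mul_corrProduct_mul
        (ν := (volume : Measure (ℝ × ℝ))) (ρ := (volume : Measure ℝ)) hf hg hφ hc₁ hk₂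
      exact h
  · have hk₁ : Continuous fun w : (ℝ × ℝ) × ℝ => quatKernel quatI A₁ w.2 w.1.1 :=
      .quatKernel _ hb₁ (by fun_prop) (by fun_prop)
    by_cases hb₂ : A₂.b = 0
    · simp only [wvdQOLCT, if_neg hb₁, if_pos hb₂]
      have hφ : Measurable fun w : (ℝ × ℝ) × ℝ => (w.2, A₂.d * (w.1.2 - A₂.r)) := by fun_prop
      have h := aestronglyMeasurable_integral_mul_corrProduct_mul
        (ν := (volume : Measure (ℝ × ℝ))) (ρ := (volume : Measure ℝ)) hf hg hφ hk₁ hc₂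
      exact h
    · simp only [wvdQOLCT, if_neg hb₁, if_neg hb₂]
      have hk₁ : Continuous fun w : (ℝ × ℝ) × (ℝ × ℝ) => quatKernel quatI A₁ w.2.1 w.1.1 :=
        .quatKernel _ hb₁ (by fun_prop) (by fun_prop)
      have hk₂ : Continuous fun w : (ℝ × ℝ) × (ℝ × ℝ) => quatKernel quatJ A₂ w.2.2 w.1.2 :=
        .quatKernel _ hb₂ (by fun_prop) (by fun_prop)
      have h := aestronglyMeasurable_integral_mul_corrProduct_mul
        (ν := (volume : Measure (ℝ × ℝ))) (ρ := (volume : Measure (ℝ × ℝ)))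
        hf hg measurable_snd hk₁ hk₂
      exact h

theorem aestronglyMeasurable_corrProduct_right (hf : AEStronglyMeasurable f)
    (hg : AEStronglyMeasurable g) (t : ℝ × ℝ) : AEStronglyMeasurable (corrProduct f g t) := by
  have hs : ∀ a : ℝ, a ≠ 0 → Measure.QuasiMeasurePreserving (fun n : ℝ × ℝ => t + a • n) :=
    fun a ha => (measurePreserving_add_left volume t).quasiMeasurePreserving.comp
      ⟨by fun_prop, by
        rw [Measure.map_addHaar_smul _ ha]; exact Measure.smul_absolutelyContinuous⟩
  have h1 := hf.comp_quasiMeasurePreserving (hs (1 / 2) (by norm_num))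
  have h2 := hg.comp_quasiMeasurePreserving (hs (-(1 / 2)) (by norm_num))
  refine h1.mul (continuous_star.comp_aestronglyMeasurable (h2.congr ?_))
  exact Filter.Eventually.of_forall fun z => by simp [sub_eq_add_neg]

/-- Holds for every `t`: the product of two norms is at most the sum of their squares, which are
integrable after translation and scaling. -/
theorem integrable_corrProduct (hf : MemLp f 2) (hg : MemLp g 2) (t : ℝ × ℝ) :
    Integrable (corrProduct f g t) := by
  have h1 := (((memLp_two_iff_integrable_sq_norm hf.1).mp hf).comp_add_left t).comp_smul
    (R := (1 / 2 : ℝ)) (by norm_num)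
  have h2 := (((memLp_two_iff_integrable_sq_norm hg.1).mp hg).comp_add_left t).comp_smul
    (R := (-(1 / 2) : ℝ)) (by norm_num)
  refine (h1.add h2).mono' (aestronglyMeasurable_corrProduct_right hf.1 hg.1 t)
    (Filter.Eventually.of_forall fun n => ?_)
  simp only [corrProduct, norm_mul, norm_star, Pi.add_apply, neg_smul, ← sub_eq_add_neg]
  nlinarith [sq_nonneg (‖f (t + (1 / 2 : ℝ) • n)‖ - ‖g (t - (1 / 2 : ℝ) • n)‖),
    sq_nonneg (‖f (t + (1 / 2 : ℝ) • n)‖), sq_nonneg (‖g (t - (1 / 2 : ℝ) • n)‖)]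

/-- Translating `t` by `n / 2` turns the arguments into `t + n` and `t`; integrating over `n` first
then separates `f` from `g`. -/
theorem lintegral_enorm_sq_corrProduct (hf : AEStronglyMeasurable f)
    (hg : AEStronglyMeasurable g) :
    ∫⁻ t, ∫⁻ n, ‖corrProduct f g t n‖ₑ ^ 2 = (∫⁻ x, ‖f x‖ₑ ^ 2) * ∫⁻ x, ‖g x‖ₑ ^ 2 := by
  have hF := hf.enorm.pow_const 2
  have hG := hg.enorm.pow_const 2
  have hshift : ∀ n : ℝ × ℝ, ∫⁻ t, ‖corrProduct f g t n‖ₑ ^ 2 =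
      ∫⁻ t, ‖f (t + n)‖ₑ ^ 2 * ‖g t‖ₑ ^ 2 := by
    intro n
    rw [← lintegral_add_right_eq_self _ ((1 / 2 : ℝ) • n)]
    refine lintegral_congr fun t => ?_
    have e : t + (1 / 2 : ℝ) • n + (1 / 2 : ℝ) • n = t + n := by
      rw [add_assoc, ← add_smul]; norm_num
    rw [corrProduct, e, add_sub_cancel_right, enorm_mul, mul_pow]
    congr 2
    rw [← ofReal_norm, ← ofReal_norm, norm_star]
  rw [lintegral_lintegral_swap]
  · simp_rw [hshift]
    rw [lintegral_lintegral_swap]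
    · have hinner : ∀ t : ℝ × ℝ, ∫⁻ n, ‖f (t + n)‖ₑ ^ 2 * ‖g t‖ₑ ^ 2 =
          (∫⁻ x, ‖f x‖ₑ ^ 2) * ‖g t‖ₑ ^ 2 := by
        intro t
        have hFt : AEMeasurable fun n => ‖f (t + n)‖ₑ ^ 2 := hF.comp_quasiMeasurePreserving
          (measurePreserving_add_left volume t).quasiMeasurePreserving
        rw [lintegral_mul_const'' _ hFt, lintegral_add_left_eq_self
          (fun x => ‖f x‖ₑ ^ 2)]
      simp_rw [hinner]
      exact lintegral_const_mul'' _ hG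
    · have h1 : AEMeasurable (fun z : (ℝ × ℝ) × (ℝ × ℝ) => ‖f (z.1 + z.2)‖ₑ ^ 2)
          (volume.prod volume) :=
        hF.comp_quasiMeasurePreserving (quasiMeasurePreserving_add_comp (φ := id) measurable_id)
      have h1' : AEMeasurable (fun z : (ℝ × ℝ) × (ℝ × ℝ) => ‖f (z.2 + z.1)‖ₑ ^ 2)
          (volume.prod volume) := by simpa only [add_comm] using h1
      exact h1'.mul hG.comp_snd
  · exact (aestronglyMeasurable_corrProduct hf hg measurable_id).enorm.pow_const 2

theorem lintegral_enorm_sq_wvdQOLCT (A₁ A₂ : OLCTParam) (hf : MemLp f 2) (hg : MemLp g 2) :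
    ∫⁻ p : (ℝ × ℝ) × (ℝ × ℝ), ‖wvdQOLCT A₁ A₂ f g p.1 p.2‖ₑ ^ 2 =
      eLpNorm f 2 volume ^ 2 * eLpNorm g 2 volume ^ 2 := by
  have hW := aestronglyMeasurable_wvdQOLCT A₁ A₂ hf.1 hg.1
  have hcorr := lintegral_enorm_sq_corrProduct hf.1 hg.1
  rw [lintegral_enorm_sq_eq_eLpNorm f, lintegral_enorm_sq_eq_eLpNorm g] at hcorr
  have hfin : ∫⁻ t, ∫⁻ n, ‖corrProduct f g t n‖ₑ ^ 2 ≠ ⊤ := by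
    rw [hcorr]
    exact ENNReal.mul_ne_top (ENNReal.pow_ne_top hf.2.ne) (ENNReal.pow_ne_top hg.2.ne)
  have hcm : AEMeasurable (fun z : (ℝ × ℝ) × (ℝ × ℝ) => ‖corrProduct f g z.1 z.2‖ₑ ^ 2)
      (volume.prod volume) :=
    (aestronglyMeasurable_corrProduct hf.1 hg.1 measurable_id).enorm.pow_const 2
  have hsec : ∀ᵐ t : ℝ × ℝ, AEStronglyMeasurable fun u => wvdQOLCT A₁ A₂ f g t u :=
    hW.prodMk_left
  rw [← hcorr, Measure.volume_eq_prod, lintegral_prod _ (hW.enorm.pow_const 2)]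
  refine lintegral_congr_ae ?_
  -- Finiteness of the double integral makes the section at almost every `t` square integrable.
  filter_upwards [hsec, ae_lt_top' hcm.lintegral_prod_right' hfin] with t ht hlt
  -- `wvdQOLCT A₁ A₂ f g t` agrees by definition with `qolct A₁ A₂ (corrProduct f g t)`.
  refine lintegral_enorm_sq_qolct (integrable_corrProduct hf hg t)
    ⟨aestronglyMeasurable_corrProduct_right hf.1 hg.1 t, ?_⟩ ht
  rw [lintegral_enorm_sq_eq_eLpNorm] at hlt
  by_contra hcon
  rw [not_lt, top_le_iff] at hcon
  simp [hcon] at hlt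

end Correlation

/-! ### Passage from lower integrals to real-valued norms and Bochner integrals. -/

theorem theorem3p6 (A₁ A₂ : OLCTParam) (f g : ℝ × ℝ → ℍ)
    (hf : MemLp f 2 (volume : Measure (ℝ × ℝ)))
    (hg : MemLp g 2 (volume : Measure (ℝ × ℝ))) :
    MemLp (fun p : (ℝ × ℝ) × (ℝ × ℝ) => wvdQOLCT A₁ A₂ f g p.1 p.2) 2 volume ∧
    ∫ t : ℝ × ℝ, ∫ u : ℝ × ℝ, ‖wvdQOLCT A₁ A₂ f g t u‖ ^ 2 =
      (eLpNorm (fun p : (ℝ × ℝ) × (ℝ × ℝ) => wvdQOLCT A₁ A₂ f g p.1 p.2) 2 volume).toReal ^ 2 ∧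
    (eLpNorm (fun p : (ℝ × ℝ) × (ℝ × ℝ) => wvdQOLCT A₁ A₂ f g p.1 p.2) 2 volume).toReal ^ 2 =
      (eLpNorm f 2 volume).toReal ^ 2 * (eLpNorm g 2 volume).toReal ^ 2 := by
  have hW : AEStronglyMeasurable
      (fun p : (ℝ × ℝ) × (ℝ × ℝ) => wvdQOLCT A₁ A₂ f g p.1 p.2) volume :=
    aestronglyMeasurable_wvdQOLCT A₁ A₂ hf.1 hg.1
  have hnorm := lintegral_enorm_sq_wvdQOLCT A₁ A₂ hf hg
  rw [lintegral_enorm_sq_eq_eLpNorm] at hnorm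
  have hmem : MemLp (fun p : (ℝ × ℝ) × (ℝ × ℝ) => wvdQOLCT A₁ A₂ f g p.1 p.2) 2 volume := by
    refine ⟨hW, ?_⟩
    by_contra hcon
    rw [not_lt, top_le_iff] at hcon
    rw [hcon, ENNReal.top_pow (by norm_num)] at hnorm
    exact ENNReal.mul_ne_top (ENNReal.pow_ne_top hf.2.ne) (ENNReal.pow_ne_top hg.2.ne) hnorm.symm
  refine ⟨hmem, ?_, ?_⟩
  -- Fubini for the iterated Bochner integral needs integrability on the product, which the `L²`
  -- membership just proved supplies.
  · have hint := (memLp_two_iff_integrable_sq_norm hW).mp hmem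
    rw [← ENNReal.toReal_pow, ← lintegral_enorm_sq_eq_eLpNorm,
      ← integral_prod (fun p : (ℝ × ℝ) × (ℝ × ℝ) => ‖wvdQOLCT A₁ A₂ f g p.1 p.2‖ ^ 2) hint,
      ← Measure.volume_eq_prod, integral_eq_lintegral_of_nonneg_ae (Filter.Eventually.of_forall fun p => by positivity)
        hint.1]
    congr 1
    refine lintegral_congr fun p => ?_
    rw [ENNReal.ofReal_pow (norm_nonneg _), ofReal_norm]
  · rw [← ENNReal.toReal_pow, hnorm, ENNReal.toReal_mul, ENNReal.toReal_pow, ENNReal.toReal_pow]
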